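/- Let $X_0=(X_0(t))_{t\ge 0}$ be a Lévy process in $\mathbb{R}^d$ started at zero (almost surely $X_0(0)=0$, independent and stationary increments, continuous in probability), and let $X(t)=x+X_0(t)$ under $E_x$. Then $X_0$ has a characteristic exponent $\psi:\mathbb{R}^d\to\mathbb{C}$, i.e. $E[e^{ik\cdot X_0(t)}]=e^{t\psi(k)}$ for all $t\ge 0$, $k\in\mathbb{R}^d$. With $\hat f(k)=\int_{\mathbb{R}^d}e^{-ik\cdot x}f(x)\,dx$, let $L_x$ be the operator on (complex) $L^1(\mathbb{R}^d)$ with domain $$D(L_x)=\{f\in L^1(\mathbb{R}^d):\ \psi(k)\hat f(k)=\hat h(k)\ \text{for all } k,\ \text{for some } h\in L^1(\mathbb{R}^d)\},\qquad L_xf=h .$$ This operator is the infinitesimal generator of the semigroup $P(t)f(x)=E_x[f(X(t))]=E[f(x+X_0(t))]$ on $L^1(\mathbb{R}^d)$: one has $f\in D(L_x)$ and $L_xf=h$ if and only if $(P(t)f-f)/t\to h$ in $L^1(\mathbb{R}^d)$ as $t\downarrow 0$. Let $\alpha\in(0,1)$, and for a function $u$ of $t\ge 0$ with values in $L^1(\mathbb{R}^d)$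 let $$T_\alpha u(t)=\lim_{\varepsilon\to 0}\frac{u(t+\varepsilon t^{1-\alpha})-u(t)}{\varepsilon},\qquad t>0,$$ be its conformable derivative (limit in $L^1(\mathbb{R}^d)$). Then for every $f\in D(L_x)$ the conformable Cauchy problem $$T_\alpha u(t)=L_xu(t),\quad t>0,\qquad u(0)=f,$$ has exactly one solution, where a solution is a continuous function $u:[0,\infty)\to L^1(\mathbb{R}^d)$ with $u(0)=f$ such that for every $t>0$ one has $u(t)\in D(L_x)$, $T_\alpha u(t)$ exists and the equation holds in $L^1(\mathbb{R}^d)$. This solution is $$u(t,x)=P(t^\alpha/\alpha)f(x)=E_x\big[f(X(t^\alpha/\alpha))\big]$$ for all $t\ge 0$ and almost every $x\in\mathbb{R}^d$, the expectation being absolutely convergent. -/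

import Mathlib

open MeasureTheory ProbabilityTheory Filter Topology Set
open scoped NNReal

noncomputable section

namespace ConformableLevy

/-- Complex-valued `L¹(ℝᵈ)` (with Lebesgue measure). -/
abbrev L1 (d : ℕ) : Type := Lp ℂ 1 (volume : Measure (EuclideanSpace ℝ (Fin d)))

/-- `X` is a Lévy process in `ℝᵈ` started at zero: almost surely `X 0 = 0`, the increments are
independent and stationary, and the process is continuous in probability. -/
structure IsLevyProcess {Ω : Type*} [MeasurableSpace Ω] {d : ℕ}
    (X : ℝ≥0 → Ω → EuclideanSpace ℝ (Fin d)) (P : Measure Ω) : Prop where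
  measurable : ∀ t, Measurable (X t)
  zero : ∀ᵐ ω ∂P, X 0 ω = 0
  indep : HasIndepIncrements X P
  stationary : ∀ s t, IdentDistrib (fun ω => X (s + t) ω - X s ω) (X t) P P
  stochCont : ∀ t, TendstoInMeasure P X (𝓝 t) (X t)

/-- The Fourier transform `f̂(k) = ∫ exp(-i k·x) f(x) dx`. -/
def fourierHat {d : ℕ} (f : EuclideanSpace ℝ (Fin d) → ℂ) (k : EuclideanSpace ℝ (Fin d)) : ℂ :=
  ∫ x, Complex.exp (-(Complex.I * (inner ℝ k x : ℝ))) * f x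

/-- The Lévy symbol `ψ(k) = d/dt E[exp(i k·X(t))]` at `t = 0+`; for a Lévy process it is the unique
function with `E[exp(i k·X(t))] = exp(t ψ(k))` for all `t ≥ 0`. -/
def levySymbol {Ω : Type*} [MeasurableSpace Ω] {d : ℕ}
    (X : ℝ≥0 → Ω → EuclideanSpace ℝ (Fin d)) (P : Measure Ω)
    (k : EuclideanSpace ℝ (Fin d)) : ℂ :=
  derivWithin (fun t : ℝ => ∫ ω, Complex.exp (Complex.I * (inner ℝ k (X t.toNNReal ω) : ℝ)) ∂P)
    (Ici 0) 0

/-- The graph of the pseudo-differential operator `L_x` on `L¹(ℝᵈ)` with symbol `ψ`: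
`f` is in the domain and `L_x f = h` when `ψ f̂ = ĥ`. -/
def IsPseudoDiff {d : ℕ} (ψ : EuclideanSpace ℝ (Fin d) → ℂ) (f h : L1 d) : Prop :=
  ∀ k, ψ k * fourierHat f k = fourierHat h k

/-- The domain `D(L_x) = {f ∈ L¹ : ψ f̂ = ĥ for some h ∈ L¹}`. -/
def pseudoDiffDomain {d : ℕ} (ψ : EuclideanSpace ℝ (Fin d) → ℂ) : Set (L1 d) :=
  {f | ∃ h, IsPseudoDiff ψ f h}

theorem integrable_prod_translate {Ω : Type*} [MeasurableSpace Ω] {d : ℕ} {P : Measure Ω}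
    [IsProbabilityMeasure P] {Y : Ω → EuclideanSpace ℝ (Fin d)} (hY : Measurable Y)
    {f : EuclideanSpace ℝ (Fin d) → ℂ} (hf : Integrable f) :
    Integrable (fun p : EuclideanSpace ℝ (Fin d) × Ω => f (p.1 + Y p.2)) (volume.prod P) := by
  have h1 : MeasurePreserving
      (fun p : Ω × EuclideanSpace ℝ (Fin d) => (p.1, p.2 + Y p.1))
      (P.prod volume) (P.prod volume) := by
    refine MeasurePreserving.skew_product (g := fun ω x => x + Y ω)
      (MeasurePreserving.id P) (by fun_prop) ?_
    exact ae_of_all _ fun ω => (measurePreserving_add_right volume (Y ω)).map_eq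
  have h2 : Integrable (fun p : Ω × EuclideanSpace ℝ (Fin d) => f p.2) (P.prod volume) :=
    hf.comp_snd P
  have h3 := (h1.integrable_comp h2.aestronglyMeasurable).2 h2
  exact h3.swap

theorem integrable_expect_translate {Ω : Type*} [MeasurableSpace Ω] {d : ℕ} {P : Measure Ω}
    [IsProbabilityMeasure P] {Y : Ω → EuclideanSpace ℝ (Fin d)} (hY : Measurable Y)
    {f : EuclideanSpace ℝ (Fin d) → ℂ} (hf : Integrable f) :
    Integrable (fun x => ∫ ω, f (x + Y ω) ∂P) :=
  (integrable_prod_translate hY hf).integral_prod_left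

/-- The semigroup `P(t) f (x) = E_x[f(X(t))] = E[f(x + X₀(t))]` on `L¹(ℝᵈ)`. -/
def levySemigroup {Ω : Type*} [MeasurableSpace Ω] {d : ℕ} {P : Measure Ω} [IsProbabilityMeasure P]
    {X : ℝ≥0 → Ω → EuclideanSpace ℝ (Fin d)} (hX : IsLevyProcess X P) (t : ℝ≥0) (f : L1 d) : L1 d :=
  (integrable_expect_translate (P := P) (hX.measurable t) (L1.integrable_coeFn f)).toL1
    (fun x => ∫ ω, f (x + X t ω) ∂P)

/-- `u` has conformable derivative `T_α u(t) = u'` at `t > 0`: the limit, in norm, of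
`(u(t + ε t^(1-α)) - u(t)) / ε` as `ε → 0`. -/
def HasConformableDerivAt {V : Type*} [NormedAddCommGroup V] [NormedSpace ℝ V]
    (α : ℝ) (u : ℝ → V) (u' : V) (t : ℝ) : Prop :=
  Tendsto (fun ε : ℝ => ε⁻¹ • (u (t + ε * t ^ (1 - α)) - u t)) (𝓝[≠] 0) (𝓝 u')

/-- `u : [0, ∞) → L¹(ℝᵈ)` solves `T_α u(t) = L_x u(t)` for `t > 0`, `u(0) = f`, where `L_x` has
symbol `ψ`: it is continuous, and for `t > 0` one has `u(t) ∈ D(L_x)` and the equation holds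
in `L¹(ℝᵈ)`.  The values of `u` at negative times play no role. -/
structure IsConformableSolution {d : ℕ} (α : ℝ) (ψ : EuclideanSpace ℝ (Fin d) → ℂ)
    (f : L1 d) (u : ℝ → L1 d) : Prop where
  continuousOn : ContinuousOn u (Ici 0)
  initial : u 0 = f
  equation : ∀ t : ℝ, 0 < t → ∃ h : L1 d, IsPseudoDiff ψ (u t) h ∧ HasConformableDerivAt α u h t

end ConformableLevy

end

/-!
The Fourier transform diagonalizes everything. By independence and stationarity of the increments,
`t ↦ E[exp (i k·X(t))]` is a multiplicative semigroup of complex numbers, continuous because the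
process is continuous in probability; hence it is `exp (t ψ(k))`
(`IsLevyProcess.charFun_eq_exp`). By Fubini, `P(t) f` then has Fourier transform
`exp (t ψ) f̂` (`fourierHat_levySemigroup`), and `t ↦ P(t) f` is continuous in `L¹`, since
`P(t) f` averages translates of `f` and translation is continuous in `L¹`
(`continuous_levySemigroup`).

Identities in `L¹` may be checked one frequency at a time, the Fourier transform being injective
(`eq_of_fourierHat_eq`) and its evaluation at a frequency being a bounded functional on `L¹`. If
`ψ f̂ = ĥ`, this gives `P(t) f = f + ∫₀ᵗ P(r) h dr` (`levySemigroup_eq_add_integral`), so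
`d/dt P(t) f = P(t) h`, and the operator with symbol `ψ` is the generator of the semigroup
(`isPseudoDiff_iff_tendsto`).

For `t > 0` the conformable derivative is `t ^ (1 - α)` times the ordinary one
(`hasConformableDerivAt_iff`), so the time change `t ↦ t ^ α / α` turns orbits of the semigroup
into solutions. Conversely, the Fourier transform of a solution at each frequency solves a linear
scalar equation, which determines it (`IsConformableSolution.fourierHat_eq`), and uniqueness
follows from injectivity.
-/

noncomputable section

namespace ConformableLevy

/-! ### Scalar semigroups -/

/-- Constancy from a vanishing derivative on the open half-line and continuity up to `0`; no
derivative at `0` is needed, since neither a solution of the Cauchy problem nor `t ↦ t ^ α` need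
be differentiable there. -/
theorem eq_of_hasDerivAt_zero {V : Type*} [NormedAddCommGroup V] [NormedSpace ℝ V]
    [CompleteSpace V] {y : ℝ → V} {t : ℝ}
    (ht : 0 ≤ t) (hc : ContinuousOn y (Ici 0)) (hd : ∀ s, 0 < s → HasDerivAt y 0 s) :
    y t = y 0 := by
  have := intervalIntegral.integral_eq_sub_of_hasDerivAt_of_le ht (hc.mono Icc_subset_Ici_self)
    (fun s hs => hd s hs.1) (by simp)
  exact sub_eq_zero.1 (by simpa using this.symm)

theorem hasDerivAt_cexp_ofReal_mul (z : ℂ) (s : ℝ) :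
    HasDerivAt (fun s : ℝ => Complex.exp (s * z)) (Complex.exp (s * z) * z) s := by
  have : HasDerivAt (fun s : ℝ => (s : ℂ) * z) z s := by
    simpa using (Complex.ofRealCLM.hasDerivAt (x := s)).mul_const z
  exact this.cexp

/-- A continuous one-parameter semigroup of complex numbers is `t ↦ exp (t z)`. Averaging over
`[0, a]` shows that it is differentiable. -/
theorem exists_eq_exp_of_map_add {φ : ℝ≥0 → ℂ} (hc : Continuous φ) (h0 : φ 0 = 1)
    (hadd : ∀ s t, φ (s + t) = φ s * φ t) :
    ∃ z : ℂ, HasDerivWithinAt (fun t : ℝ => φ t.toNNReal) z (Ici 0) 0 ∧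
      ∀ t : ℝ≥0, φ t = Complex.exp ((t : ℝ) * z) := by
  set Φ : ℝ → ℂ := fun t => φ t.toNNReal with hΦ
  have hΦc : Continuous Φ := hc.comp continuous_real_toNNReal
  have hΦ0 : Φ 0 = 1 := by simp [hΦ, h0]
  have hΦadd : ∀ s t, 0 ≤ s → 0 ≤ t → Φ (s + t) = Φ s * Φ t := by
    intro s t hs ht
    simp only [hΦ, Real.toNNReal_add hs ht, hadd]
  set J : ℝ → ℂ := fun t => ∫ s in (0 : ℝ)..t, Φ s with hJ
  have hJd : ∀ t, HasDerivAt J (Φ t) t := fun t =>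
    intervalIntegral.integral_hasDerivAt_right (hΦc.intervalIntegrable _ _)
      hΦc.stronglyMeasurable.stronglyMeasurableAtFilter hΦc.continuousAt
  -- `J` has slope `1` at the origin, so it does not vanish on a right neighbourhood of it.
  obtain ⟨a, ha, hJa⟩ : ∃ a : ℝ, 0 < a ∧ J a ≠ 0 := by
    by_contra! hcon
    have h1 : HasDerivWithinAt J 0 (Ici 0) 0 := by
      refine (hasDerivWithinAt_const (0 : ℝ) (Ici 0) (0 : ℂ)).congr (fun x hx => ?_) (by simp [hJ])
      rcases (mem_Ici.1 hx).eq_or_lt with rfl | hx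
      · simp [hJ]
      · exact hcon x hx
    have h2 := (hJd 0).hasDerivWithinAt (s := Ici 0)
    have := (uniqueDiffOn_Ici (0 : ℝ) 0 self_mem_Ici).eq_deriv _ h1 h2
    simp [hΦ0] at this
  have hrep : ∀ t, 0 ≤ t → Φ t = (J (t + a) - J t) / J a := by
    intro t ht
    rw [eq_div_iff hJa]
    have h1 : J (t + a) - J t = ∫ s in t..(t + a), Φ s :=
      intervalIntegral.integral_interval_sub_left (hΦc.intervalIntegrable _ _)
        (hΦc.intervalIntegrable _ _)
    have h2 : ∫ s in t..(t + a), Φ s = ∫ s in (0 : ℝ)..a, Φ (t + s) := by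
      rw [intervalIntegral.integral_comp_add_left]; simp
    rw [h1, h2, hJ]
    simp only
    rw [← intervalIntegral.integral_const_mul]
    refine intervalIntegral.integral_congr fun s hs => ?_
    rw [uIcc_of_le ha.le] at hs
    exact (hΦadd t s ht hs.1).symm
  set z := (Φ a - 1) / J a with hz
  have hd : ∀ t, 0 ≤ t → HasDerivWithinAt Φ (Φ t * z) (Ici 0) t := by
    intro t ht
    have h1 : HasDerivAt (fun t => (J (t + a) - J t) / J a) ((Φ (t + a) - Φ t) / J a) t :=
      (((hJd (t + a)).comp_add_const t a).sub (hJd t)).div_const _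
    have h2 : (Φ (t + a) - Φ t) / J a = Φ t * z := by rw [hΦadd t a ht ha.le, hz]; ring
    rw [← h2]
    exact h1.hasDerivWithinAt.congr (fun x hx => hrep x hx) (hrep t ht)
  refine ⟨z, by simpa [hΦ0] using hd 0 le_rfl, fun t => ?_⟩
  have hconst := eq_of_hasDerivAt_zero (y := fun s : ℝ => Φ s * Complex.exp (s * -z)) t.2
    (by fun_prop) (fun s hs =>
      (((hd s hs.le).hasDerivAt (Ici_mem_nhds hs)).fun_mul
        (hasDerivAt_cexp_ofReal_mul (-z) s)).congr_deriv (by ring))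
  have h3 : Φ t * Complex.exp ((t : ℝ) * -z) = 1 := by simpa [hΦ0] using hconst
  have h4 : φ t = Φ t := by simp [hΦ]
  rw [h4, ← mul_one (Complex.exp _), ← h3, mul_left_comm, ← Complex.exp_add]
  simp

/-! ### The characteristic exponent -/

/-- Convergence in probability is preserved, in the mean, by a bounded continuous map with values
in a normed space. -/
theorem tendsto_integral_norm_sub_of_tendstoInMeasure {Ω ι E V : Type*} [MeasurableSpace Ω]
    {P : Measure Ω} [IsFiniteMeasure P] [PseudoEMetricSpace E] [MeasurableSpace E] [BorelSpace E]
    [NormedAddCommGroup V] {l : Filter ι} [l.IsCountablyGenerated]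
    {Y : ι → Ω → E} {Z : Ω → E} {g : E → V} {C : ℝ} (hg : Continuous g) (hC : ∀ x, ‖g x‖ ≤ C)
    (hmeas : ∀ i, AEStronglyMeasurable (fun ω => ‖g (Y i ω) - g (Z ω)‖) P)
    (h : TendstoInMeasure P Y l Z) :
    Tendsto (fun i => ∫ ω, ‖g (Y i ω) - g (Z ω)‖ ∂P) l (𝓝 0) := by
  refine tendsto_of_subseq_tendsto fun ns hns => ?_
  obtain ⟨ms, -, hms⟩ := (h.comp hns).exists_seq_tendsto_ae
  refine ⟨ms, ?_⟩
  have := tendsto_integral_of_dominated_convergence (μ := P) (f := fun _ => (0 : ℝ))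
    (F := fun n ω => ‖g (Y (ns (ms n)) ω) - g (Z ω)‖) (fun _ => C + C)
    (fun n => hmeas _) (integrable_const _)
    (fun n => ae_of_all _ fun ω => by
      rw [norm_norm]
      exact (norm_sub_le _ _).trans (add_le_add (hC _) (hC _)))
    (by
      filter_upwards [hms] with ω hω
      have := ((hg.tendsto (Z ω)).comp hω).sub_const (g (Z ω))
      simpa using this.norm)
  simpa using this

section CharacteristicExponent

variable {Ω : Type*} [MeasurableSpace Ω] {P : Measure Ω} {d : ℕ}
  {X : ℝ≥0 → Ω → EuclideanSpace ℝ (Fin d)}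

theorem norm_cexp_I_mul_inner (k x : EuclideanSpace ℝ (Fin d)) :
    ‖Complex.exp (Complex.I * (inner ℝ k x : ℝ))‖ = 1 := by
  rw [mul_comm, Complex.norm_exp_ofReal_mul_I]

theorem integrable_cexp_I_mul_inner [IsFiniteMeasure P]
    {Y : Ω → EuclideanSpace ℝ (Fin d)} (hY : Measurable Y)
    (k : EuclideanSpace ℝ (Fin d)) :
    Integrable (fun ω => Complex.exp (Complex.I * (inner ℝ k (Y ω) : ℝ))) P :=
  .of_bound (by fun_prop) 1 (ae_of_all _ fun ω => (norm_cexp_I_mul_inner k (Y ω)).le)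

/-- The semigroup law of the characteristic functions, from `X (s + t) = X s + (X (s + t) - X s)`
with independent summands, the second distributed as `X t`. -/
theorem IsLevyProcess.charFun_add (hX : IsLevyProcess X P) (k : EuclideanSpace ℝ (Fin d))
    (s t : ℝ≥0) :
    ∫ ω, Complex.exp (Complex.I * (inner ℝ k (X (s + t) ω) : ℝ)) ∂P =
      (∫ ω, Complex.exp (Complex.I * (inner ℝ k (X s ω) : ℝ)) ∂P) *
        ∫ ω, Complex.exp (Complex.I * (inner ℝ k (X t ω) : ℝ)) ∂P := by
  set e : EuclideanSpace ℝ (Fin d) → ℂ :=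
    fun x => Complex.exp (Complex.I * (inner ℝ k x : ℝ)) with he
  have hem : Measurable e := by fun_prop
  have hind := (hX.indep.indepFun_sub_sub zero_le (le_self_add (a := s) (b := t))).comp hem hem
  have hprod := hind.integral_fun_mul_eq_mul_integral
    (hem.comp ((hX.measurable s).sub (hX.measurable 0))).aestronglyMeasurable
    (hem.comp ((hX.measurable (s + t)).sub (hX.measurable s))).aestronglyMeasurable
  have h1 : ∫ ω, e (X (s + t) ω) ∂P =
      ∫ ω, (e ∘ (X s - X 0)) ω * (e ∘ (X (s + t) - X s)) ω ∂P := by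
    refine integral_congr_ae ?_
    filter_upwards [hX.zero] with ω hω
    simp only [he, Function.comp, Pi.sub_apply, hω, sub_zero, ← Complex.exp_add, ← mul_add,
      ← Complex.ofReal_add, ← inner_add_right, add_sub_cancel]
  have h2 : ∫ ω, (e ∘ (X s - X 0)) ω ∂P = ∫ ω, e (X s ω) ∂P := by
    refine integral_congr_ae ?_
    filter_upwards [hX.zero] with ω hω
    simp [hω]
  have h3 : ∫ ω, (e ∘ (X (s + t) - X s)) ω ∂P = ∫ ω, e (X t ω) ∂P :=
    ((hX.stationary s t).comp hem).integral_eq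
  rw [h1, hprod, h2, h3]

variable [IsProbabilityMeasure P]

theorem IsLevyProcess.continuous_charFun (hX : IsLevyProcess X P)
    (k : EuclideanSpace ℝ (Fin d)) :
    Continuous fun t => ∫ ω, Complex.exp (Complex.I * (inner ℝ k (X t ω) : ℝ)) ∂P := by
  refine continuous_iff_continuousAt.2 fun t => tendsto_iff_norm_sub_tendsto_zero.2 ?_
  have hm := hX.measurable
  have := tendsto_integral_norm_sub_of_tendstoInMeasure (P := P)
    (g := fun x => Complex.exp (Complex.I * (inner ℝ k x : ℝ)))
    (by fun_prop) (fun x => (norm_cexp_I_mul_inner k x).le) (fun s => by fun_prop) (hX.stochCont t)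
  refine squeeze_zero (fun _ => norm_nonneg _) (fun s => ?_) this
  rw [← integral_sub (integrable_cexp_I_mul_inner (hm s) k) (integrable_cexp_I_mul_inner (hm t) k)]
  exact norm_integral_le_integral_norm _

theorem IsLevyProcess.charFun_eq_exp (hX : IsLevyProcess X P) (t : ℝ≥0)
    (k : EuclideanSpace ℝ (Fin d)) :
    ∫ ω, Complex.exp (Complex.I * (inner ℝ k (X t ω) : ℝ)) ∂P =
      Complex.exp ((t : ℝ) * levySymbol X P k) := by
  have h0 : ∫ ω, Complex.exp (Complex.I * (inner ℝ k (X 0 ω) : ℝ)) ∂P = 1 := by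
    rw [integral_congr_ae (g := fun _ => (1 : ℂ))]
    · simp
    · filter_upwards [hX.zero] with ω hω
      simp [hω]
  obtain ⟨z, hz, hexp⟩ := exists_eq_exp_of_map_add (hX.continuous_charFun k) h0 (hX.charFun_add k)
  rw [levySymbol, hz.derivWithin (uniqueDiffOn_Ici _ _ self_mem_Ici), hexp t]

end CharacteristicExponent

/-! ### The Fourier transform on `L¹` -/

open scoped FourierTransform in
/-- As `g` is itself the Fourier transform of a Schwartz function, the pairing can be moved to the
frequency side. -/
theorem integral_mul_eq_zero_of_fourier_eq_zero {V : Type*} [NormedAddCommGroup V]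
    [InnerProductSpace ℝ V] [MeasurableSpace V] [BorelSpace V] [FiniteDimensional ℝ V]
    {f : V → ℂ} (hf : Integrable f) (h : ∀ w, 𝓕 f w = 0) (g : SchwartzMap V ℂ) :
    ∫ x, f x * g x = 0 := by
  have h1 := VectorFourier.integral_fourierIntegral_smul_eq_flip (L := innerₗ V) (μ := volume)
    (ν := volume) Real.continuous_fourierChar continuous_inner hf
    (𝓕⁻ g : SchwartzMap V ℂ).integrable
  have h2 : ∀ w, VectorFourier.fourierIntegral Real.fourierChar volume (innerₗ V) f w = 0 := h
  have h3 : ∀ x, VectorFourier.fourierIntegral Real.fourierChar volume (innerₗ V)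
      (𝓕⁻ g : SchwartzMap V ℂ) x = g x := by
    intro x
    have h4 : 𝓕 (𝓕⁻ g : SchwartzMap V ℂ) x = g x := by
      rw [FourierTransform.fourier_fourierInv_eq]
    rw [← h4, SchwartzMap.fourier_coe]
    rfl
  simpa [h2, h3] using h1.symm

open scoped FourierTransform in
theorem ae_eq_zero_of_fourier_eq_zero {V : Type*} [NormedAddCommGroup V]
    [InnerProductSpace ℝ V] [MeasurableSpace V] [BorelSpace V] [FiniteDimensional ℝ V]
    {f : V → ℂ} (hf : Integrable f) (h : ∀ w, 𝓕 f w = 0) : f =ᵐ[volume] 0 := by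
  refine ae_eq_zero_of_integral_contDiff_smul_eq_zero hf.locallyIntegrable fun g hg hs => ?_
  have hs' : HasCompactSupport fun x => (g x : ℂ) := hs.comp_left Complex.ofReal_zero
  have := integral_mul_eq_zero_of_fourier_eq_zero hf h
    (hs'.toSchwartzMap (Complex.ofRealCLM.contDiff.comp hg))
  rw [← this]
  congr with x
  exact (Complex.real_smul ..).trans (mul_comm _ _)

theorem norm_cexp_neg_I_mul_inner {d : ℕ} (k x : EuclideanSpace ℝ (Fin d)) :
    ‖Complex.exp (-(Complex.I * (inner ℝ k x : ℝ)))‖ = 1 := by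
  rw [Complex.exp_neg, norm_inv, norm_cexp_I_mul_inner, inv_one]

theorem integrable_cexp_mul {d : ℕ} (k : EuclideanSpace ℝ (Fin d))
    {f : EuclideanSpace ℝ (Fin d) → ℂ} (hf : Integrable f) :
    Integrable fun x => Complex.exp (-(Complex.I * (inner ℝ k x : ℝ))) * f x :=
  hf.bdd_mul (c := 1) (by fun_prop) (ae_of_all _ fun x => (norm_cexp_neg_I_mul_inner k x).le)

theorem fourierHat_congr {d : ℕ} {f g : EuclideanSpace ℝ (Fin d) → ℂ} (h : f =ᵐ[volume] g)
    (k : EuclideanSpace ℝ (Fin d)) : fourierHat f k = fourierHat g k :=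
  integral_congr_ae (h.mono fun x hx => by simp only [hx])

/-- Evaluation of the Fourier transform at the frequency `k`, as a bounded functional on `L¹`. -/
def fourierHatCLM {d : ℕ} (k : EuclideanSpace ℝ (Fin d)) : L1 d →L[ℝ] ℂ :=
  LinearMap.mkContinuous
    { toFun := fun f => fourierHat f k
      map_add' := fun f g => by
        rw [fourierHat_congr (Lp.coeFn_add f g) k, fourierHat, fourierHat, fourierHat,
          ← integral_add (integrable_cexp_mul k (L1.integrable_coeFn f))
            (integrable_cexp_mul k (L1.integrable_coeFn g))]
        simp only [Pi.add_apply, mul_add]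
      map_smul' := fun c f => by
        rw [fourierHat_congr (Lp.coeFn_smul c f) k, fourierHat, fourierHat, ← integral_smul]
        simp only [Pi.smul_apply, mul_smul_comm, RingHom.id_apply] } 1
    fun f => by
      rw [one_mul, L1.norm_eq_integral_norm]
      refine (norm_integral_le_integral_norm _).trans_eq ?_
      simp only [norm_mul, norm_cexp_neg_I_mul_inner, one_mul]

@[simp]
theorem fourierHatCLM_apply {d : ℕ} (k : EuclideanSpace ℝ (Fin d)) (f : L1 d) :
    fourierHatCLM k f = fourierHat f k := rfl

open scoped FourierTransform in
/-- Comparison with Mathlib's normalization of the Fourier transform. -/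
theorem fourierHat_two_pi_smul {d : ℕ} (f : EuclideanSpace ℝ (Fin d) → ℂ)
    (w : EuclideanSpace ℝ (Fin d)) : fourierHat f ((2 * Real.pi) • w) = 𝓕 f w := by
  rw [Real.fourier_eq', fourierHat]
  congr with x
  rw [smul_eq_mul, real_inner_smul_left, real_inner_comm]
  congr 2
  push_cast
  ring

/-- The Fourier transform is injective on `L¹`. -/
theorem eq_of_fourierHat_eq {d : ℕ} {f g : L1 d} (h : ∀ k, fourierHat f k = fourierHat g k) :
    f = g := by
  rw [← sub_eq_zero, Lp.eq_zero_iff_ae_eq_zero]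
  refine ae_eq_zero_of_fourier_eq_zero (L1.integrable_coeFn _) fun w => ?_
  rw [← fourierHat_two_pi_smul, ← fourierHatCLM_apply, map_sub, fourierHatCLM_apply,
    fourierHatCLM_apply, h, sub_self]

/-! ### The semigroup on `L¹` -/

section Semigroup

variable {Ω : Type*} [MeasurableSpace Ω] {P : Measure Ω} [IsProbabilityMeasure P] {d : ℕ}
  {X : ℝ≥0 → Ω → EuclideanSpace ℝ (Fin d)}

theorem levySemigroup_coeFn (hX : IsLevyProcess X P) (t : ℝ≥0) (f : L1 d) :
    levySemigroup hX t f =ᵐ[volume] fun x => ∫ ω, f (x + X t ω) ∂P :=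
  Integrable.coeFn_toL1 _

theorem integrable_prod_levy (hX : IsLevyProcess X P) (t : ℝ≥0) (f : L1 d) :
    Integrable (fun p : EuclideanSpace ℝ (Fin d) × Ω => f (p.1 + X t p.2)) (volume.prod P) :=
  integrable_prod_translate (hX.measurable t) (L1.integrable_coeFn f)

theorem fourierHat_translate (f : EuclideanSpace ℝ (Fin d) → ℂ)
    (k y : EuclideanSpace ℝ (Fin d)) :
    fourierHat (fun x => f (x + y)) k =
      Complex.exp (Complex.I * (inner ℝ k y : ℝ)) * fourierHat f k := by
  have := integral_add_right_eq_self (μ := volume)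
    (fun x => Complex.exp (-(Complex.I * (inner ℝ k (x - y) : ℝ))) * f x) y
  simp only [add_sub_cancel_right] at this
  rw [fourierHat, this, fourierHat, ← integral_const_mul]
  congr with x
  rw [← mul_assoc, ← Complex.exp_add, inner_sub_right]
  congr 2
  push_cast
  ring

/-- The semigroup acts on the Fourier side as multiplication by `exp (t ψ)`. -/
theorem fourierHat_levySemigroup (hX : IsLevyProcess X P) (t : ℝ≥0) (f : L1 d)
    (k : EuclideanSpace ℝ (Fin d)) :
    fourierHat (levySemigroup hX t f) k =
      Complex.exp ((t : ℝ) * levySymbol X P k) * fourierHat f k := by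
  rw [fourierHat_congr (levySemigroup_coeFn hX t f), fourierHat]
  simp only [← integral_const_mul]
  have hint : Integrable (fun p : EuclideanSpace ℝ (Fin d) × Ω =>
      Complex.exp (-(Complex.I * (inner ℝ k p.1 : ℝ))) * f (p.1 + X t p.2)) (volume.prod P) :=
    (integrable_prod_levy hX t f).bdd_mul (c := 1) (by fun_prop)
      (ae_of_all _ fun p => (norm_cexp_neg_I_mul_inner k p.1).le)
  rw [integral_integral_swap hint, ← hX.charFun_eq_exp, ← integral_mul_const]
  exact integral_congr_ae (ae_of_all _ fun ω => fourierHat_translate f k (X t ω))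

/-- The translate `x ↦ f (x + y)` of an integrable function, as an element of `L¹`. -/
def translate (y : EuclideanSpace ℝ (Fin d)) (f : L1 d) : L1 d :=
  DomAddAct.mk y +ᵥ f

theorem translate_coeFn (y : EuclideanSpace ℝ (Fin d)) (f : L1 d) :
    translate y f =ᵐ[volume] fun x => f (x + y) := by
  refine (DomAddAct.vadd_Lp_ae_eq _ f).trans (ae_of_all _ fun x => ?_)
  simp [add_comm]

theorem norm_translate (y : EuclideanSpace ℝ (Fin d)) (f : L1 d) : ‖translate y f‖ = ‖f‖ :=
  DomAddAct.norm_vadd_Lp _ _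

theorem continuous_translate (f : L1 d) : Continuous fun y => translate y f := by
  have : Fact ((1 : ENNReal) ≠ ⊤) := ⟨ENNReal.one_ne_top⟩
  exact (DomAddAct.continuous_mk).vadd continuous_const

/-- Minkowski's inequality for the average `P(t) f` of the translates of `f`: increments of the
semigroup are controlled by the mean `L¹` distance of the translates. -/
theorem norm_levySemigroup_sub_le (hX : IsLevyProcess X P) (s t : ℝ≥0) (f : L1 d) :
    ‖levySemigroup hX s f - levySemigroup hX t f‖ ≤
      ∫ ω, ‖translate (X s ω) f - translate (X t ω) f‖ ∂P := by
  have hs := integrable_prod_levy hX s f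
  have ht := integrable_prod_levy hX t f
  rw [L1.norm_eq_integral_norm]
  have h1 : ∀ᵐ x, ‖(levySemigroup hX s f - levySemigroup hX t f : L1 d) x‖ ≤
      ∫ ω, ‖f (x + X s ω) - f (x + X t ω)‖ ∂P := by
    filter_upwards [levySemigroup_coeFn hX s f, levySemigroup_coeFn hX t f,
      Lp.coeFn_sub (levySemigroup hX s f) (levySemigroup hX t f), hs.prod_right_ae,
      ht.prod_right_ae] with x h1 h2 h3 h4 h5
    rw [h3, Pi.sub_apply, h1, h2, ← integral_sub h4 h5]
    exact norm_integral_le_integral_norm _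
  refine (integral_mono_ae (L1.integrable_coeFn _).norm (hs.sub ht).norm.integral_prod_left
    h1).trans_eq ?_
  rw [integral_integral_swap (hs.sub ht).norm]
  refine integral_congr_ae (ae_of_all _ fun ω => ?_)
  simp only [L1.norm_eq_integral_norm]
  refine integral_congr_ae ?_
  filter_upwards [translate_coeFn (X s ω) f, translate_coeFn (X t ω) f,
    Lp.coeFn_sub (translate (X s ω) f) (translate (X t ω) f)] with x h1 h2 h3
  simp only [h3, Pi.sub_apply, h1, h2]

/-- Strong continuity: translation is continuous in `L¹` and the process is continuous in
probability. -/
theorem continuous_levySemigroup (hX : IsLevyProcess X P) (f : L1 d) :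
    Continuous fun t => levySemigroup hX t f := by
  refine continuous_iff_continuousAt.2 fun t => tendsto_iff_norm_sub_tendsto_zero.2 ?_
  refine squeeze_zero (fun _ => norm_nonneg _) (fun s => norm_levySemigroup_sub_le hX s t f) ?_
  have hc := continuous_translate f
  have hsm (s : ℝ≥0) : StronglyMeasurable fun ω => translate (X s ω) f :=
    hc.stronglyMeasurable.comp_measurable (hX.measurable s)
  exact tendsto_integral_norm_sub_of_tendstoInMeasure (g := fun y => translate y f) (Y := X)
    (Z := X t) (C := ‖f‖) hc (fun y => (norm_translate y f).le)
    (fun s => ((hsm s).sub (hsm t)).norm.aestronglyMeasurable) (hX.stochCont t)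

end Semigroup

/-! ### The generator -/

section Generator

variable {Ω : Type*} [MeasurableSpace Ω] {P : Measure Ω} [IsProbabilityMeasure P] {d : ℕ}
  {X : ℝ≥0 → Ω → EuclideanSpace ℝ (Fin d)}

theorem continuous_levySemigroup_toNNReal (hX : IsLevyProcess X P) (f : L1 d) :
    Continuous fun t : ℝ => levySemigroup hX t.toNNReal f :=
  (continuous_levySemigroup hX f).comp continuous_real_toNNReal

theorem levySemigroup_zero (hX : IsLevyProcess X P) (f : L1 d) : levySemigroup hX 0 f = f :=
  eq_of_fourierHat_eq fun k => by simp [fourierHat_levySemigroup]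

theorem IsPseudoDiff.levySemigroup (hX : IsLevyProcess X P) {f h : L1 d}
    (hfh : IsPseudoDiff (levySymbol X P) f h) (t : ℝ≥0) :
    IsPseudoDiff (levySymbol X P) (levySemigroup hX t f) (levySemigroup hX t h) := fun k => by
  rw [fourierHat_levySemigroup, fourierHat_levySemigroup, ← hfh k]
  ring

/-- Duhamel's formula `P(t) f = f + ∫₀ᵗ P(r) h dr` for `h = L_x f`: on the Fourier side it is the
fundamental theorem of calculus for `r ↦ exp (r ψ(k)) f̂(k)`. -/
theorem levySemigroup_eq_add_integral (hX : IsLevyProcess X P) {f h : L1 d}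
    (hfh : IsPseudoDiff (levySymbol X P) f h) {t : ℝ} (ht : 0 ≤ t) :
    levySemigroup hX t.toNNReal f = f + ∫ r in (0 : ℝ)..t, levySemigroup hX r.toNNReal h := by
  refine eq_of_fourierHat_eq fun k => ?_
  have hint : fourierHatCLM k (∫ r in (0 : ℝ)..t, levySemigroup hX r.toNNReal h) =
      ∫ r in (0 : ℝ)..t,
        Complex.exp (r * levySymbol X P k) * levySymbol X P k * fourierHat f k := by
    rw [← ContinuousLinearMap.intervalIntegral_comp_comm _
      ((continuous_levySemigroup_toNNReal hX h).intervalIntegrable _ _)]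
    refine intervalIntegral.integral_congr fun r hr => ?_
    rw [uIcc_of_le ht] at hr
    simp only [fourierHatCLM_apply, fourierHat_levySemigroup, Real.coe_toNNReal r hr.1, mul_assoc,
      hfh k]
  have hftc := intervalIntegral.integral_eq_sub_of_hasDerivAt (a := 0) (b := t)
    (fun r _ => (hasDerivAt_cexp_ofReal_mul (levySymbol X P k) r).mul_const (fourierHat f k))
    (Continuous.intervalIntegrable (by fun_prop) _ _)
  rw [← fourierHatCLM_apply k (f + _), map_add, hint, hftc, fourierHatCLM_apply,
    fourierHat_levySemigroup, Real.coe_toNNReal t ht]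
  simp

theorem hasDerivWithinAt_levySemigroup (hX : IsLevyProcess X P) {f h : L1 d}
    (hfh : IsPseudoDiff (levySymbol X P) f h) {t : ℝ} (ht : 0 ≤ t) :
    HasDerivWithinAt (fun t : ℝ => levySemigroup hX t.toNNReal f)
      (levySemigroup hX t.toNNReal h) (Ici 0) t := by
  have hc := continuous_levySemigroup_toNNReal hX h
  have h1 : HasDerivAt (fun t => f + ∫ r in (0 : ℝ)..t, levySemigroup hX r.toNNReal h)
      (levySemigroup hX t.toNNReal h) t :=
    (intervalIntegral.integral_hasDerivAt_right (hc.intervalIntegrable _ _)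
      hc.stronglyMeasurable.stronglyMeasurableAtFilter hc.continuousAt).const_add f
  exact h1.hasDerivWithinAt.congr (fun s hs => levySemigroup_eq_add_integral hX hfh hs)
    (levySemigroup_eq_add_integral hX hfh ht)

theorem tendsto_nnreal_coe_nhdsGT_zero :
    Tendsto (fun t : ℝ≥0 => (t : ℝ)) (𝓝[>] 0) (𝓝[>] 0) :=
  tendsto_nhdsWithin_iff.2
    ⟨(NNReal.continuous_coe.tendsto' 0 0 rfl).mono_left nhdsWithin_le_nhds,
      eventually_mem_nhdsWithin.mono fun t ht => by simpa using ht⟩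

/-- The pseudo-differential operator is the infinitesimal generator of the semigroup. -/
theorem isPseudoDiff_iff_tendsto (hX : IsLevyProcess X P) (f h : L1 d) :
    IsPseudoDiff (levySymbol X P) f h ↔
      Tendsto (fun t : ℝ≥0 => (t : ℝ)⁻¹ • (levySemigroup hX t f - f)) (𝓝[>] 0) (𝓝 h) := by
  constructor
  · intro hfh
    have h1 := (hasDerivWithinAt_levySemigroup hX hfh le_rfl).mono Ioi_subset_Ici_self
    rw [hasDerivWithinAt_iff_tendsto_slope' self_notMem_Ioi] at h1
    have h2 := h1.comp tendsto_nnreal_coe_nhdsGT_zero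
    simpa [Function.comp_def, slope_def_module, levySemigroup_zero] using h2
  · intro hlim k
    have h1 := ((fourierHatCLM k).continuous.tendsto h).comp hlim
    have h2 := ((hasDerivAt_cexp_ofReal_mul (levySymbol X P k) 0).mul_const
      (fourierHat f k)).hasDerivWithinAt (s := Ioi 0)
    rw [hasDerivWithinAt_iff_tendsto_slope' self_notMem_Ioi] at h2
    have h3 := h2.comp tendsto_nnreal_coe_nhdsGT_zero
    refine tendsto_nhds_unique ?_ h1
    simpa [Function.comp_def, slope_def_module, fourierHat_levySemigroup, map_sub] using h3

end Generator

/-! ### The conformable Cauchy problem -/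

/-- At positive times the conformable derivative exists exactly when the ordinary one does, and
`T_α u(t) = t ^ (1 - α) u'(t)`. -/
theorem hasConformableDerivAt_iff {V : Type*} [NormedAddCommGroup V] [NormedSpace ℝ V]
    {α t : ℝ} (ht : 0 < t) (u : ℝ → V) (u' : V) :
    HasConformableDerivAt α u u' t ↔ HasDerivAt u (t ^ (α - 1) • u') t := by
  have hc : t ^ (α - 1) * t ^ (1 - α) = 1 := by
    rw [← Real.rpow_add ht]; simp
  have hc0 : t ^ (1 - α) ≠ 0 := (Real.rpow_pos_of_pos ht _).ne'
  have h1 : HasConformableDerivAt α u u' t ↔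
      HasDerivAt (fun ε => u (t + ε * t ^ (1 - α))) u' 0 := by
    rw [hasDerivAt_iff_tendsto_slope_zero, HasConformableDerivAt]
    simp
  rw [h1]
  constructor
  · intro h
    have h2 : HasDerivAt (fun s => (s - t) * t ^ (α - 1)) (t ^ (α - 1)) t := by
      simpa using ((hasDerivAt_id t).sub_const t).mul_const (t ^ (α - 1))
    have h3 := HasDerivAt.scomp_of_eq t h h2 (by simp)
    refine h3.congr_of_eventuallyEq (Eventually.of_forall fun s => ?_)
    simp [mul_assoc, hc]
  · intro h
    have h2 : HasDerivAt (fun ε => t + ε * t ^ (1 - α)) (t ^ (1 - α)) 0 := by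
      simpa using ((hasDerivAt_id (0 : ℝ)).mul_const (t ^ (1 - α))).const_add t
    have h3 := HasDerivAt.scomp_of_eq (0 : ℝ) h h2 (by simp)
    rwa [smul_smul, mul_comm, hc, one_smul] at h3

theorem hasDerivAt_rpow_div {α t : ℝ} (hα : 0 < α) (ht : 0 < t) :
    HasDerivAt (fun s : ℝ => s ^ α / α) (t ^ (α - 1)) t := by
  have := (Real.hasDerivAt_rpow_const (p := α) (Or.inl ht.ne')).div_const α
  rwa [mul_div_cancel_left₀ _ hα.ne'] at this

section CauchyProblem

variable {Ω : Type*} [MeasurableSpace Ω] {P : Measure Ω} [IsProbabilityMeasure P] {d : ℕ}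
  {X : ℝ≥0 → Ω → EuclideanSpace ℝ (Fin d)}

theorem isConformableSolution_levySemigroup (hX : IsLevyProcess X P) {α : ℝ} (hα : 0 < α)
    {f h : L1 d} (hfh : IsPseudoDiff (levySymbol X P) f h) :
    IsConformableSolution α (levySymbol X P) f
      (fun t => levySemigroup hX (t ^ α / α).toNNReal f) where
  continuousOn := ((continuous_levySemigroup_toNNReal hX f).comp
    ((Real.continuous_rpow_const hα.le).div_const α)).continuousOn
  initial := by simp [Real.zero_rpow hα.ne', levySemigroup_zero]
  equation t ht := by
    refine ⟨levySemigroup hX (t ^ α / α).toNNReal h, hfh.levySemigroup hX _, ?_⟩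
    rw [hasConformableDerivAt_iff ht]
    have hpos : 0 < t ^ α / α := div_pos (Real.rpow_pos_of_pos ht _) hα
    exact HasDerivAt.scomp t
      ((hasDerivWithinAt_levySemigroup hX hfh hpos.le).hasDerivAt (Ici_mem_nhds hpos))
      (hasDerivAt_rpow_div hα ht)

/-- The Fourier transform of a solution satisfies the scalar equation `y' = t ^ (α - 1) ψ(k) y`,
hence `exp (-ψ(k) t ^ α / α) y(t)` is constant. -/
theorem IsConformableSolution.fourierHat_eq {ψ : EuclideanSpace ℝ (Fin d) → ℂ} {α : ℝ}
    (hα : 0 < α) {f : L1 d} {v : ℝ → L1 d} (hv : IsConformableSolution α ψ f v)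
    {t : ℝ} (ht : 0 ≤ t) (k : EuclideanSpace ℝ (Fin d)) :
    fourierHat (v t) k = Complex.exp ((t ^ α / α : ℝ) * ψ k) * fourierHat f k := by
  have hconst := eq_of_hasDerivAt_zero
    (y := fun s : ℝ => Complex.exp ((s ^ α / α : ℝ) * -ψ k) * fourierHatCLM k (v s)) ht
    (by
      have h1 : Continuous fun s : ℝ => s ^ α / α :=
        (Real.continuous_rpow_const hα.le).div_const α
      have h2 := (fourierHatCLM k).continuous.comp_continuousOn hv.continuousOn
      have h3 : Continuous fun s : ℝ => Complex.exp ((s ^ α / α : ℝ) * -ψ k) :=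
        Complex.continuous_exp.comp ((Complex.continuous_ofReal.comp h1).mul_const _)
      exact h3.continuousOn.mul h2)
    (fun s hs => by
      obtain ⟨h, hh, hd⟩ := hv.equation s hs
      rw [hasConformableDerivAt_iff hs] at hd
      have h1 := (hasDerivAt_cexp_ofReal_mul (-ψ k) (s ^ α / α)).scomp s (hasDerivAt_rpow_div hα hs)
      have h2 := (fourierHatCLM k).hasFDerivAt.comp_hasDerivAt s hd
      refine (h1.fun_mul h2).congr_deriv ?_
      simp only [Function.comp_apply, map_smul, fourierHatCLM_apply, ← hh k, Complex.real_smul]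
      ring)
  simp only [Real.zero_rpow hα.ne', hv.initial, fourierHatCLM_apply, zero_div, Complex.ofReal_zero,
    zero_mul, Complex.exp_zero, one_mul] at hconst
  rw [← hconst, ← mul_assoc, ← Complex.exp_add]
  simp

theorem IsConformableSolution.eq_levySemigroup (hX : IsLevyProcess X P) {α : ℝ} (hα : 0 < α)
    {f : L1 d} {v : ℝ → L1 d} (hv : IsConformableSolution α (levySymbol X P) f v)
    {t : ℝ} (ht : 0 ≤ t) : v t = levySemigroup hX (t ^ α / α).toNNReal f :=
  eq_of_fourierHat_eq fun k => by
    rw [hv.fourierHat_eq hα ht, fourierHat_levySemigroup,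
      Real.coe_toNNReal _ (div_nonneg (Real.rpow_nonneg ht _) hα.le)]

theorem levySemigroup_ae_eq_expect (hX : IsLevyProcess X P) (t : ℝ≥0) (f : L1 d) :
    ∀ᵐ x : EuclideanSpace ℝ (Fin d), Integrable (fun ω => f (x + X t ω)) P ∧
      levySemigroup hX t f x = ∫ ω, f (x + X t ω) ∂P :=
  (integrable_prod_levy hX t f).prod_right_ae.and (levySemigroup_coeFn hX t f)

end CauchyProblem

end ConformableLevy

end

theorem mainTheorem3 {Ω : Type*} [MeasurableSpace Ω] (P : Measure Ω) [IsProbabilityMeasure P]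
    (d : ℕ) (X : ℝ≥0 → Ω → EuclideanSpace ℝ (Fin d)) (hX : ConformableLevy.IsLevyProcess X P) :
    -- the symbol is the characteristic exponent of the process
    (∀ (t : ℝ≥0) (k : EuclideanSpace ℝ (Fin d)),
      ∫ ω, Complex.exp (Complex.I * (inner ℝ k (X t ω) : ℝ)) ∂P =
        Complex.exp ((t : ℝ) * ConformableLevy.levySymbol X P k)) ∧
    -- the operator with this symbol is the infinitesimal generator of the semigroup
    (∀ f h : ConformableLevy.L1 d,
      ConformableLevy.IsPseudoDiff (ConformableLevy.levySymbol X P) f h ↔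
        Tendsto (fun t : ℝ≥0 => (t : ℝ)⁻¹ • (ConformableLevy.levySemigroup hX t f - f))
          (𝓝[>] 0) (𝓝 h)) ∧
    -- existence, the stochastic representation, and uniqueness
    ∀ α : ℝ, 0 < α → α < 1 →
      ∀ f ∈ ConformableLevy.pseudoDiffDomain (ConformableLevy.levySymbol X P),
        ConformableLevy.IsConformableSolution α (ConformableLevy.levySymbol X P) f
          (fun t => ConformableLevy.levySemigroup hX (t ^ α / α).toNNReal f) ∧
        (∀ t : ℝ, 0 ≤ t → ∀ᵐ x : EuclideanSpace ℝ (Fin d),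
          Integrable (fun ω => f (x + X (t ^ α / α).toNNReal ω)) P ∧
          ConformableLevy.levySemigroup hX (t ^ α / α).toNNReal f x =
            ∫ ω, f (x + X (t ^ α / α).toNNReal ω) ∂P) ∧
        ∀ v : ℝ → ConformableLevy.L1 d,
          ConformableLevy.IsConformableSolution α (ConformableLevy.levySymbol X P) f v →
          ∀ t : ℝ, 0 ≤ t → v t = ConformableLevy.levySemigroup hX (t ^ α / α).toNNReal f :=
  ⟨hX.charFun_eq_exp, ConformableLevy.isPseudoDiff_iff_tendsto hX,
    fun _α hα _ f hf =>
      ⟨hf.elim fun _ hh => ConformableLevy.isConformableSolution_levySemigroup hX hα hh,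
        fun _ _ => ConformableLevy.levySemigroup_ae_eq_expect hX _ f,
        fun _ hv _ ht => hv.eq_levySemigroup hX hα ht⟩⟩
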